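/- All vector spaces are over a field $\mathbb F$ of characteristic $0$. In expressions $(y\pm z)^n$, $n\in\mathbb Z$, and in $f(y+z)$ one expands in nonnegative powers of the second variable $z$; $\delta(x)=\sum_{n\in\mathbb Z}x^n$; $T(u\otimes v)=v\otimes u$. The graded dual of a graded space $W=\coprod_k W_{(k)}$ is $W'=\coprod_k \mathrm{Hom}(W_{(k)},\mathbb F)$, and tensor products carry the total grading. Let $(V,Y_V,c)$ be a graded vertex coalgebra. That is, $V=\coprod_{k\in\mathbb Z}V_{(k)}$ with $V_{(k)}=0$ for $k\ll 0$; $c:V\to\mathbb F$ and $Y_V(x):V\to (V\otimes V)[[x,x^{-1}]]$ are linear, $Y_V(x)v=\sum_{k\in\mathbb Z}\Delta_k(v)x^{-k-1}$ with $\Delta_k(v)\in (V\otimes V)_{(r+k+1)}$ for $v\in V_{(r)}$; and for all $v\in V$: $(c\otimes Id_V)Y_V(x)v=v$; $(Id_V\otimes c)Y_V(x)v\in V[[x]]$ with constant term $v$; $Y_V(x)v\in(V\otimes V)((x^{-1}))$; and the Jacobi identity (J) below holds with $M=V$, $Y_M=Y_V$. Let $M=\coprod_{j\in\mathbb Q}M_{(j)}$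 be a $\mathbb Q$-graded vector space with $M_{(j)}=0$ for $j\ll 0$, and let $Y_M(x):M\to(V\otimes M)[[x,x^{-1}]]$ be a linear map, $Y_M(x)w=\sum_{k\in\mathbb Z}\Delta_k(w)x^{-k-1}$ with $\Delta_k(w)\in(V\otimes M)_{(j+k+1)}$ for $w\in M_{(j)}$. Suppose that for all $w\in M$ 1. (left counit) $(c\otimes Id_M)Y_M(x)w=w$; 2. (truncation) $Y_M(x)w\in(V\otimes M)((x^{-1}))$; and that 3. (weak coassociativity) for every $v'\in(V\otimes V\otimes M)'$ there is a nonnegative integer $k$ such that for all $w\in M$ $$(x_0+x_2)^k\langle v',(Y_V(x_0)\otimes Id_M)Y_M(x_2)w-(Id_V\otimes Y_M(x_2))Y_M(x_0+x_2)w\rangle=0 .$$ Then $M$ satisfies the Jacobi identity $$(\mathrm J)\quad x_0^{-1}\delta\Big(\frac{x_1-x_2}{x_0}\Big)(Id_V\otimes Y_M(x_2))Y_M(x_1)-x_0^{-1}\delta\Big(\frac{x_2-x_1}{-x_0}\Big)(T\otimes Id_M)(Id_V\otimes Y_M(x_1))Y_M(x_2)=x_2^{-1}\delta\Big(\frac{x_1-x_0}{x_2}\Big)(Y_V(x_0)\otimes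 Id_M)Y_M(x_2).$$ Moreover, with $D^*=Res_x\,x^{-2}(Id_V\otimes c)Y_V(x)$, the map $Y_M$ satisfies $$(e^{x_0D^*}\otimes Id_M)Y_M(x_2)=Y_M(x_2+x_0).$$ -/

import Mathlib

open scoped TensorProduct

namespace VertexCoalgebra

section FormalSeries

/-! Formal series in one, two or three variables, infinite in all directions, are
functions from the exponents (`ℤ`, `ℤ × ℤ`, `ℤ × ℤ × ℤ`) to the coefficients. -/

variable (F : Type*) [Field F]

/-- The coefficient of `y ^ e.1 * z ^ e.2` in `(y + ε z) ^ n`, `n ∈ ℤ`, expanded in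
nonnegative powers of the second variable `z`. -/
def binomExp (ε : F) (n : ℤ) (e : ℤ × ℤ) : F :=
  if 0 ≤ e.2 ∧ e.1 + e.2 = n then ((Ring.choose n e.2.toNat : ℤ) : F) * ε ^ e.2.toNat else 0

variable {F} {W : Type*} [AddCommGroup W] [Module F W]

/-- Multiplication of a vector-valued formal series by a scalar-valued one. It is only used
where each coefficient is a finite sum. -/
noncomputable def cauchyMul {G : Type*} [AddCommGroup G] (f : G → F) (g : G → W) : G → W :=
  fun e => ∑ᶠ d : G, f d • g (e - d)

/-- The series `f(y + z)`, expanded in nonnegative powers of `z`; the exponents are those of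
`(y, z)`. -/
noncomputable def substAdd (f : ℤ → W) : ℤ × ℤ → W :=
  fun e => ∑ᶠ n : ℤ, binomExp F 1 n e • f n

variable (F)

/-- `x₀⁻¹ δ((x₁ - x₂) / x₀) = ∑ₙ (x₁ - x₂)ⁿ x₀⁻ⁿ⁻¹`; exponents are those of `(x₀, x₁, x₂)`. -/
def delta₁ (e : ℤ × ℤ × ℤ) : F :=
  binomExp F (-1) (-e.1 - 1) (e.2.1, e.2.2)

/-- `x₀⁻¹ δ((x₂ - x₁) / (-x₀)) = ∑ₙ (-1)ⁿ (x₂ - x₁)ⁿ x₀⁻ⁿ⁻¹`; exponents are those of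
`(x₀, x₁, x₂)`. -/
def delta₂ (e : ℤ × ℤ × ℤ) : F :=
  (-1 : F) ^ (-e.1 - 1) * binomExp F (-1) (-e.1 - 1) (e.2.2, e.2.1)

/-- `x₂⁻¹ δ((x₁ - x₀) / x₂) = ∑ₙ (x₁ - x₀)ⁿ x₂⁻ⁿ⁻¹`; exponents are those of `(x₀, x₁, x₂)`. -/
def delta₃ (e : ℤ × ℤ × ℤ) : F :=
  binomExp F (-1) (-e.2.2 - 1) (e.2.1, e.1)

end FormalSeries

section Axioms

variable {F : Type*} [Field F] {V : Type*} [AddCommGroup V] [Module F V]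
  {M : Type*} [AddCommGroup M] [Module F M]

/-- For a linear map `Y(x) : M → (V ⊗ M)[[x, x⁻¹]]`, the coefficient of `x ^ n` as a linear map
`M → V ⊗ M`. -/
def coeff (Y : M →ₗ[F] (ℤ → V ⊗[F] M)) (n : ℤ) : M →ₗ[F] V ⊗[F] M :=
  LinearMap.proj n ∘ₗ Y

/-- The operator `Δ_k` in `Y(x) = ∑_k Δ_k x ^ (-k-1)`. -/
def comult (Y : M →ₗ[F] (ℤ → V ⊗[F] M)) (k : ℤ) : M →ₗ[F] V ⊗[F] M :=
  coeff Y (-k - 1)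

/-- `c ⊗ Id_M`, with values in `M`. -/
def counitLeft (M : Type*) [AddCommGroup M] [Module F M] (c : V →ₗ[F] F) :
    V ⊗[F] M →ₗ[F] M :=
  (TensorProduct.lid F M).toLinearMap ∘ₗ LinearMap.rTensor M c

/-- `Id_V ⊗ c`, with values in `V`. -/
def counitRight (c : V →ₗ[F] F) : V ⊗[F] V →ₗ[F] V :=
  (TensorProduct.rid F V).toLinearMap ∘ₗ LinearMap.lTensor V c

/-- Left counit axiom: `(c ⊗ Id_M) Y(x) w = w`. -/
def LeftCounit (c : V →ₗ[F] F) (YM : M →ₗ[F] (ℤ → V ⊗[F] M)) : Prop :=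
  ∀ (w : M) (n : ℤ), counitLeft M c (YM w n) = if n = 0 then w else 0

/-- Cocreation axiom: `(Id_V ⊗ c) Y(x) v ∈ V[[x]]`, with constant term `v`. -/
def Cocreation (c : V →ₗ[F] F) (Y : V →ₗ[F] (ℤ → V ⊗[F] V)) : Prop :=
  ∀ v : V, (∀ n : ℤ, n < 0 → counitRight c (Y v n) = 0) ∧ counitRight c (Y v 0) = v

/-- Truncation axiom: `Y(x) w ∈ (V ⊗ M)((x⁻¹))`. -/
def Truncation (YM : M →ₗ[F] (ℤ → V ⊗[F] M)) : Prop :=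
  ∀ w : M, ∃ N : ℤ, ∀ n : ℤ, N < n → YM w n = 0

/-- `(Id_V ⊗ Y_M(z)) Y_M(y) w`; exponents are those of `(y, z)`. -/
def iterRight (YM : M →ₗ[F] (ℤ → V ⊗[F] M)) (w : M) (e : ℤ × ℤ) : V ⊗[F] (V ⊗[F] M) :=
  LinearMap.lTensor V (coeff YM e.2) (YM w e.1)

/-- `(Y_V(y) ⊗ Id_M) Y_M(z) w`, in `V ⊗ V ⊗ M` bracketed to the right; exponents are those of
`(y, z)`. -/
def iterLeft (YV : V →ₗ[F] (ℤ → V ⊗[F] V)) (YM : M →ₗ[F] (ℤ → V ⊗[F] M)) (w : M)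
    (e : ℤ × ℤ) : V ⊗[F] (V ⊗[F] M) :=
  TensorProduct.assoc F V V M (LinearMap.rTensor M (coeff YV e.1) (YM w e.2))

/-- `(Id_V ⊗ Y_M(z)) Y_M(y + z) w`, with `Y_M(y + z)` expanded in nonnegative powers of `z`;
exponents are those of `(y, z)`. -/
noncomputable def iterRightShift (YM : M →ₗ[F] (ℤ → V ⊗[F] M)) (w : M) (e : ℤ × ℤ) :
    V ⊗[F] (V ⊗[F] M) :=
  ∑ᶠ i : ℤ, LinearMap.lTensor V (coeff YM (e.2 - i)) (substAdd (F := F) (YM w) (e.1, i))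

/-- The Jacobi identity. Exponents are those of `(x₀, x₁, x₂)`, and
`TensorProduct.leftComm` is `T ⊗ Id_M`. -/
def JacobiIdentity (YV : V →ₗ[F] (ℤ → V ⊗[F] V)) (YM : M →ₗ[F] (ℤ → V ⊗[F] M)) : Prop :=
  ∀ w : M,
    cauchyMul (delta₁ F)
        (fun e : ℤ × ℤ × ℤ => if e.1 = 0 then iterRight YM w (e.2.1, e.2.2) else 0) -
      cauchyMul (delta₂ F)
        (fun e : ℤ × ℤ × ℤ => if e.1 = 0 then
          TensorProduct.leftComm F V V M (iterRight YM w (e.2.2, e.2.1)) else 0) =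
    cauchyMul (delta₃ F)
        (fun e : ℤ × ℤ × ℤ => if e.2.1 = 0 then iterLeft YV YM w (e.1, e.2.2) else 0)

/-- Vertex coalgebras `(V, Y, c)`. -/
structure IsVertexCoalgebra (Y : V →ₗ[F] (ℤ → V ⊗[F] V)) (c : V →ₗ[F] F) : Prop where
  leftCounit : LeftCounit c Y
  cocreation : Cocreation c Y
  truncation : Truncation Y
  jacobi : JacobiIdentity Y Y

/-- `D* = Res_x x⁻² (Id_V ⊗ c) Y(x)`, the coefficient of `x` in `(Id_V ⊗ c) Y(x)`. -/
def Dstar (Y : V →ₗ[F] (ℤ → V ⊗[F] V)) (c : V →ₗ[F] F) : V →ₗ[F] V :=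
  counitRight c ∘ₗ coeff Y 1

/-- `(e ^ (z D) ⊗ Id_M) Y_M(y) w` for a linear map `D : V → V`; exponents are those of
`(y, z)`. -/
noncomputable def expTensor (D : V →ₗ[F] V) (YM : M →ₗ[F] (ℤ → V ⊗[F] M)) (w : M)
    (e : ℤ × ℤ) : V ⊗[F] M :=
  if 0 ≤ e.2 then
    ((e.2.toNat.factorial : F)⁻¹) • LinearMap.rTensor M (D ^ e.2.toNat) (YM w e.1)
  else 0

end Axioms

section Graded

variable {F : Type*} [Field F] {V : Type*} [AddCommGroup V] [Module F V]
  {M : Type*} [AddCommGroup M] [Module F M] {ι : Type*}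

/-- The weight spaces of `V ⊗ M`, for a `ℤ`-graded `V` and an `ι`-graded `M`
(here `ι` is `ℤ` or `ℚ`). -/
def tensorGrading [AddGroupWithOne ι] (𝒱 : ℤ → Submodule F V) (ℳ : ι → Submodule F M) (k : ι) :
    Submodule F (V ⊗[F] M) :=
  ⨆ (i : ℤ) (j : ι) (_ : (i : ι) + j = k),
    Submodule.map₂ (TensorProduct.mk F V M) (𝒱 i) (ℳ j)

/-- The graded dual `∐ₖ Hom(M₍ₖ₎, F)` as the space of linear functionals on
`M` that vanish on all but finitely many weight spaces. -/
def gradedDual (ℳ : ι → Submodule F M) : Submodule F (Module.Dual F M) where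
  carrier := {φ | {k | ∃ m ∈ ℳ k, φ m ≠ 0}.Finite}
  zero_mem' := by simp
  add_mem' := by
    intro φ ψ hφ hψ
    refine (hφ.union hψ).subset ?_
    rintro k ⟨m, hm, h⟩
    by_cases h1 : φ m = 0
    · exact Or.inr ⟨m, hm, fun h2 => h (by simp [h1, h2])⟩
    · exact Or.inl ⟨m, hm, h1⟩
  smul_mem' := by
    intro a φ hφ
    refine Set.Finite.subset hφ ?_
    rintro k ⟨m, hm, h⟩
    exact ⟨m, hm, fun h1 => h (by simp [h1])⟩

/-- `M = ∐ₖ M₍ₖ₎`, with `M₍ₖ₎ = 0` for `k ≪ 0`. -/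
structure IsLowerBoundedGrading [DecidableEq ι] [LT ι] (ℳ : ι → Submodule F M) : Prop where
  isInternal : DirectSum.IsInternal ℳ
  lowerBounded : ∃ N : ι, ∀ k : ι, k < N → ℳ k = ⊥

/-- `Δ_k` maps `M₍ⱼ₎` to `(V ⊗ M)₍ⱼ₊ₖ₊₁₎`. -/
def IsGradedMap [AddGroupWithOne ι] (𝒱 : ℤ → Submodule F V) (ℳ : ι → Submodule F M)
    (YM : M →ₗ[F] (ℤ → V ⊗[F] M)) : Prop :=
  ∀ (j : ι) (k : ℤ), ∀ w ∈ ℳ j, comult YM k w ∈ tensorGrading 𝒱 ℳ (j + (k : ι) + 1)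

/-- Graded vertex coalgebras. -/
structure IsGradedVertexCoalgebra (𝒱 : ℤ → Submodule F V) (Y : V →ₗ[F] (ℤ → V ⊗[F] V))
    (c : V →ₗ[F] F) : Prop extends IsVertexCoalgebra Y c where
  grading : IsLowerBoundedGrading 𝒱
  graded : IsGradedMap 𝒱 𝒱 Y

/-- A `ℚ`-graded vector space `M` with a map `Y_M` that satisfies all the axioms of a comodule
over the graded vertex coalgebra `(V, Y_V, c)` except the Jacobi identity. -/
structure IsGradedPrecomodule (𝒱 : ℤ → Submodule F V) (c : V →ₗ[F] F) (ℳ : ℚ → Submodule F M)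
    (YM : M →ₗ[F] (ℤ → V ⊗[F] M)) : Prop where
  leftCounit : LeftCounit c YM
  truncation : Truncation YM
  grading : IsLowerBoundedGrading ℳ
  graded : IsGradedMap 𝒱 ℳ YM

/-- Weak coassociativity: for each `v' ∈ (V ⊗ V ⊗ M)'` there is `k`, independent of `w`, with
`(x₀ + x₂)ᵏ ⟨v', (Y_V(x₀) ⊗ Id) Y_M(x₂) w - (Id ⊗ Y_M(x₂)) Y_M(x₀ + x₂) w⟩ = 0`. -/
def WeakCoassociativity (𝒱 : ℤ → Submodule F V) (YV : V →ₗ[F] (ℤ → V ⊗[F] V))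
    (ℳ : ℚ → Submodule F M) (YM : M →ₗ[F] (ℤ → V ⊗[F] M)) : Prop :=
  ∀ v' ∈ gradedDual (tensorGrading 𝒱 (tensorGrading 𝒱 ℳ)), ∃ k : ℕ, ∀ w : M,
    cauchyMul (binomExp F 1 (k : ℤ))
      (fun e : ℤ × ℤ => v' (iterLeft YV YM w e - iterRightShift YM w e)) = 0

end Graded

end VertexCoalgebra

namespace VertexCoalgebra

/-! ### Delta functions times series, and the recursion they satisfy -/

section DeltaMul

variable {F : Type*} [Field F] {W : Type*} [AddCommGroup W] [Module F W]
  {W' : Type*} [AddCommGroup W'] [Module F W']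

/-! Each term of (J) is annihilated by `x₀ - x₁ + x₂`, which in coefficients is the recursion
`DeltaRec`. A solution that vanishes for all low exponents of `x₁`, and also for all low exponents
of `x₂`, is zero (`DeltaRec.eq_zero`). So it suffices to take `w` homogeneous, pair the difference
of the two sides of (J) with a homogeneous functional, and check these two vanishing conditions.

Low powers of `x₁`: the coefficients of `x₁⁻¹` in the first and third terms are the two series of
weak coassociativity. Since `x₁` acts as `x₀ + x₂`, the factor `(x₀ + x₂)ᵏ` shifts attention to
`x₁⁻¹⁻ᵏ`, where the two terms agree, and they then agree at all lower powers
(`WeakCoassociativity.exists_deltaMul_eq`). The second term has no low powers of `x₁` after pairing,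
by weights and truncation.

Low powers of `x₂`: the difference is invariant under `T ⊗ Id` combined with `(x₀, x₁, x₂) ↦ (-x₀,
x₂, x₁)` (`jacobiDefect_swap`), which reduces this case to the previous one. Invariance of the third
term (`deltaMul_leftSeries_swap`) combines skew symmetry of `V` with the formula for `e ^ (x₀ D*)`.

That formula (`rTensor_counitCoeff`) comes from applying `c` to the middle factor of weak
coassociativity. This gives `Y_M(x₀ + x₂)`, expanded in the wrong direction, up to a power of `x₀ +
x₂`. After pairing, the powers in `Y_M` are bounded below, so a high power makes both expansions
agree. The uniqueness principle then removes that power. -/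

theorem neg_one_zpow_mul_self (a : ℤ) : (-1 : F) ^ a * (-1 : F) ^ a = 1 := by
  rw [← mul_zpow]; simp

theorem neg_one_zpow_neg_sub_one (a : ℤ) : (-1 : F) ^ (-a - 1) = -(-1 : F) ^ a := by
  rw [zpow_sub_one₀ (by simp), zpow_neg, ← inv_zpow]
  simp

/-- The coefficient of `x ^ a * y ^ b * z ^ d` in `x⁻¹ δ((y + ε z) / x) G(y, z)`. -/
noncomputable def deltaMul (ε : F) (G : ℤ → ℤ → W) (a b d : ℤ) : W :=
  ∑ᶠ i : ℕ, (((Ring.choose (-a - 1) i : ℤ) : F) * ε ^ i) • G (a + b + 1 + i) (d - i)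

/-- The exponents of the first variable of the series `G` are bounded above. -/
def UpperBounded (G : ℤ → ℤ → W) : Prop := ∃ N : ℤ, ∀ p q : ℤ, N < p → G p q = 0

theorem UpperBounded.map {G : ℤ → ℤ → W} (hG : UpperBounded G) (φ : W →ₗ[F] W') :
    UpperBounded fun p q => φ (G p q) := by
  obtain ⟨N, hN⟩ := hG
  exact ⟨N, fun p q h => by simp [hN p q h]⟩

theorem deltaMul_eq_sum (ε : F) {G : ℤ → ℤ → W} {N : ℤ} (hN : ∀ p q : ℤ, N < p → G p q = 0)
    (a b d : ℤ) {n : ℕ} (hn : N < a + b + 1 + n) :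
    deltaMul ε G a b d = ∑ i ∈ Finset.range n,
      (((Ring.choose (-a - 1) i : ℤ) : F) * ε ^ i) • G (a + b + 1 + i) (d - i) := by
  refine finsum_eq_sum_of_support_subset _ fun i hi => ?_
  simp only [Finset.coe_range, Set.mem_Iio]
  by_contra h
  exact hi (by simp only [hN _ _ (show N < a + b + 1 + (i : ℤ) by omega), smul_zero])

/-- Pascal's rule: next to `δ((y + ε z) / x)`, multiplication by `x` is multiplication by `y + ε z`.
-/
theorem deltaMul_sub_one (ε : F) {G : ℤ → ℤ → W} (hG : UpperBounded G) (a b d : ℤ) :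
    deltaMul ε G (a - 1) b d = deltaMul ε G a (b - 1) d + ε • deltaMul ε G a b (d - 1) := by
  obtain ⟨N, hN⟩ := hG
  obtain ⟨n, hn⟩ : ∃ n : ℕ, N < a + b + n := ⟨(N - a - b + 1).toNat, by omega⟩
  rw [deltaMul_eq_sum ε hN (a - 1) b d (n := n + 1) (by push_cast; omega),
    deltaMul_eq_sum ε hN a (b - 1) d (n := n + 1) (by push_cast; omega),
    deltaMul_eq_sum ε hN a b (d - 1) (n := n) (by omega),
    Finset.sum_range_succ', Finset.sum_range_succ', Finset.smul_sum,
    add_right_comm (Finset.sum _ _) _ (Finset.sum _ _),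
    ← Finset.sum_add_distrib]
  congr 1
  · refine Finset.sum_congr rfl fun i _ => ?_
    have h1 : -(a - 1) - 1 = (-a - 1) + 1 := by ring
    rw [h1, Ring.choose_succ_succ]
    have e1 : a - 1 + b + 1 + ((i + 1 : ℕ) : ℤ) = a + b + 1 + i := by push_cast; ring
    have e2 : a + (b - 1) + 1 + ((i + 1 : ℕ) : ℤ) = a + b + 1 + i := by push_cast; ring
    have e3 : d - ((i + 1 : ℕ) : ℤ) = d - 1 - i := by push_cast; ring
    rw [e1, e2, e3, smul_smul, ← add_smul]
    congr 1
    push_cast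
    ring
  · simp only [Ring.choose_zero_right]
    congr 2
    push_cast; ring

theorem map_deltaMul (φ : W →ₗ[F] W') (ε : F) {G : ℤ → ℤ → W} (hG : UpperBounded G)
    (a b d : ℤ) : φ (deltaMul ε G a b d) = deltaMul ε (fun p q => φ (G p q)) a b d := by
  obtain ⟨N, hN⟩ := hG
  obtain ⟨n, hn⟩ : ∃ n : ℕ, N < a + b + 1 + n := ⟨(N - a - b).toNat, by omega⟩
  rw [deltaMul_eq_sum ε hN a b d hn,
    deltaMul_eq_sum (G := fun p q => φ (G p q)) ε (fun p q h => by simp [hN p q h]) a b d hn]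
  simp [map_sum]

theorem deltaMul_add (ε : F) {G H : ℤ → ℤ → W} (hG : UpperBounded G) (hH : UpperBounded H)
    (a b d : ℤ) :
    deltaMul ε (fun p q => G p q + H p q) a b d = deltaMul ε G a b d + deltaMul ε H a b d := by
  obtain ⟨N, hN⟩ := hG
  obtain ⟨N', hN'⟩ := hH
  obtain ⟨n, hn⟩ : ∃ n : ℕ, max N N' < a + b + 1 + n := ⟨(max N N' - a - b).toNat, by omega⟩
  rw [deltaMul_eq_sum ε hN a b d (n := n) (by omega),
    deltaMul_eq_sum ε hN' a b d (n := n) (by omega),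
    deltaMul_eq_sum (N := max N N') ε _ a b d hn, ← Finset.sum_add_distrib]
  · simp
  · intro p q h
    simp only [hN p q (by omega), hN' p q (by omega), add_zero]

theorem deltaMul_zero (ε : F) (a b d : ℤ) :
    deltaMul ε (fun _ _ => (0 : W)) a b d = 0 := by
  simp [deltaMul]

/-- For `a = -1` the delta function has a single relevant term. -/
theorem deltaMul_neg_one (ε : F) (G : ℤ → ℤ → W) (b d : ℤ) :
    deltaMul ε G (-1) b d = G b d := by
  rw [deltaMul, finsum_eq_single _ 0]
  · simp
  · intro i hi
    obtain ⟨i, rfl⟩ := Nat.exists_eq_succ_of_ne_zero hi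
    simp [Ring.choose_zero_succ]

/-- Upper negation. In coefficients it is the identity `x⁻¹ δ((y - z) / x) = y⁻¹ δ((x + z) / y)`. -/
theorem choose_neg_sub_one (b : ℤ) (i : ℕ) :
    ((Ring.choose (-b - 1) i : ℤ) : F) = ((Ring.choose (b + i) i : ℤ) : F) * (-1) ^ i := by
  have h : -b - 1 = -(b + 1) := by ring
  rw [h, Ring.choose_neg]
  have h2 : b + 1 + (i : ℤ) - 1 = b + i := by ring
  rw [h2, Int.negOnePow_def]
  simp [Units.smul_def, mul_comm]

/-- For a series in the first variable only, a single term contributes. -/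
theorem deltaMul_const (g : ℤ → W) (a b d : ℤ) :
    deltaMul (-1 : F) (fun p q => if q = 0 then g p else 0) a b d =
      if 0 ≤ d then ((Ring.choose (a + d) d.toNat : ℤ) : F) • g (a + b + d + 1) else 0 := by
  split_ifs with h
  · obtain ⟨n, rfl⟩ := Int.eq_ofNat_of_zero_le h
    rw [deltaMul, finsum_eq_single _ n]
    · simp only [sub_self, if_true, Int.toNat_natCast, choose_neg_sub_one]
      rw [mul_assoc, ← mul_pow]
      simp only [mul_neg, mul_one, neg_neg, one_pow]
      congr 2
      ring
    · intro i hi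
      rw [if_neg (by omega), smul_zero]
  · rw [deltaMul]
    refine (finsum_congr fun i => ?_).trans finsum_zero
    rw [if_neg (by omega), smul_zero]

theorem deltaMul_eq_zero_of_le (ε : F) {G : ℤ → ℤ → W} {K : ℤ}
    (hK : ∀ p q : ℤ, q ≤ K → G p q = 0) (a b d : ℤ) (hd : d ≤ K) : deltaMul ε G a b d = 0 := by
  refine (finsum_congr fun i => ?_).trans finsum_zero
  rw [hK _ _ (by omega), smul_zero]

/-- The recursion that says that a series in `x, y, z` is annihilated by `x - y + z`. -/
def DeltaRec (X : ℤ → ℤ → ℤ → W) : Prop :=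
  ∀ a b d : ℤ, X (a - 1) b d = X a (b - 1) d - X a b (d - 1)

theorem DeltaRec.sub {X Z : ℤ → ℤ → ℤ → W} (hX : DeltaRec X) (hZ : DeltaRec Z) :
    DeltaRec fun a b d => X a b d - Z a b d := by
  intro a b d
  simp only [hX a b d, hZ a b d]
  abel

theorem DeltaRec.add {X Z : ℤ → ℤ → ℤ → W} (hX : DeltaRec X) (hZ : DeltaRec Z) :
    DeltaRec fun a b d => X a b d + Z a b d := by
  intro a b d
  simp only [hX a b d, hZ a b d]
  abel

theorem DeltaRec.map {X : ℤ → ℤ → ℤ → W} (hX : DeltaRec X) (φ : W →ₗ[F] W') :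
    DeltaRec fun a b d => φ (X a b d) := by
  intro a b d
  simp only [hX a b d, map_sub]

theorem DeltaRec.reverse {X : ℤ → ℤ → ℤ → W} (hX : DeltaRec X) :
    DeltaRec fun a b d => X d b a := by
  intro a b d
  simp only [hX d b a, sub_sub_cancel]

theorem deltaRec_deltaMul {G : ℤ → ℤ → W} (hG : UpperBounded G) :
    DeltaRec (deltaMul (-1 : F) G) := by
  intro a b d
  rw [deltaMul_sub_one _ hG, neg_one_smul]
  abel

theorem deltaRec_deltaMul_rotate {G : ℤ → ℤ → W} (hG : UpperBounded G) :
    DeltaRec fun a b d => deltaMul (1 : F) G b d a := by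
  intro a b d
  simp only [deltaMul_sub_one _ hG b d a, one_smul]
  abel

/-- The recursion is preserved by the substitution `(x, y, z) ↦ (-x, z, y)`. -/
theorem DeltaRec.swap {X : ℤ → ℤ → ℤ → W} (hX : DeltaRec X) :
    DeltaRec fun a b d => (-1 : F) ^ a • X a d b := by
  intro a b d
  simp only [hX a d b, zpow_sub_one₀ (neg_ne_zero.2 (one_ne_zero (α := F)))]
  simp only [inv_neg, inv_one, mul_neg, mul_one, neg_smul, smul_sub]
  abel

/-- Both initial conditions together determine a solution of the recursion. -/
theorem DeltaRec.eq_zero {X : ℤ → ℤ → ℤ → W} (hX : DeltaRec X) {K : ℤ}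
    (hb : ∀ a b d : ℤ, b ≤ K → X a b d = 0) (hd : ∀ a b d : ℤ, d ≤ K → X a b d = 0)
    (a b d : ℤ) : X a b d = 0 := by
  -- The recursion writes each coefficient through two others whose `b + d` is smaller by one; once
  -- `b + d ≤ 2 * K`, one of the two exponents is at most `K`.
  have key : ∀ (n : ℕ) (a b d : ℤ), b + d ≤ 2 * K + n → X a b d = 0 := by
    intro n
    induction n with
    | zero =>
      intro a b d h
      by_cases h' : b ≤ K
      · exact hb a b d h'
      · exact hd a b d (by push_cast at h; omega)
    | succ n ih =>
      intro a b d h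
      have h1 := hX (a + 1) b d
      rw [add_sub_cancel_right] at h1
      push_cast at h
      rw [h1, ih _ _ _ (by omega), ih _ _ _ (by omega), sub_zero]
  exact key (b + d - 2 * K).toNat a b d (by omega)

/-- Solved for `X a (b - 1) d`, the recursion determines the slice at `b - 1` from the slice at `b`.
-/
theorem DeltaRec.eq_zero_of_le {X : ℤ → ℤ → ℤ → W} (hX : DeltaRec X) {K : ℤ}
    (h : ∀ a d : ℤ, X a K d = 0) (a b d : ℤ) (hb : b ≤ K) : X a b d = 0 := by
  obtain ⟨n, rfl⟩ : ∃ n : ℕ, b = K - n := ⟨(K - b).toNat, by omega⟩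
  clear hb
  induction n generalizing a d with
  | zero => simpa using h a d
  | succ n ih =>
    have h1 := hX a (K - n) d
    rw [ih, ih, sub_zero] at h1
    rw [h1]
    congr 1
    push_cast
    ring

/-- The recursion expresses the coefficients through those of multiplication by `(x + z) ^ k`. -/
theorem DeltaRec.eq_sum {X : ℤ → ℤ → ℤ → W} (hX : DeltaRec X) (k : ℕ) (a b d : ℤ) :
    X a (b - k) d = ∑ ij ∈ Finset.HasAntidiagonal.antidiagonal k,
      k.choose ij.1 • X (a - ij.2) b (d - ij.1) := by
  induction k generalizing a d with
  | zero => simp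
  | succ k ih =>
    rw [Finset.sum_antidiagonal_choose_succ_nsmul (fun i j => X (a - j) b (d - i))]
    have h1 := hX a (b - k) d
    have h2 : b - ((k + 1 : ℕ) : ℤ) = b - k - 1 := by push_cast; ring
    have h3 : X a (b - k - 1) d = X (a - 1) (b - k) d + X a (b - k) (d - 1) := by
      rw [h1]; abel
    rw [h2, h3, ih, ih]
    congr 1
    · refine Finset.sum_congr rfl fun ij _ => ?_
      congr 2
      push_cast; ring
    · refine Finset.sum_congr rfl fun ij hij => ?_
      rw [Finset.HasAntidiagonal.mem_antidiagonal] at hij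
      rw [← Nat.choose_symm_of_eq_add hij.symm]
      congr 2
      push_cast; ring

end DeltaMul

/-! ### The terms of the Jacobi identity in coefficients -/

section Coefficients

theorem finsum_eq_finsum_comp {α β W : Type*} [AddCommMonoid W] {h : α → β}
    (hinj : Function.Injective h) {f : β → W} (hf : ∀ y, y ∉ Set.range h → f y = 0) :
    ∑ᶠ y, f y = ∑ᶠ i, f (h i) := by
  rw [← finsum_mem_range hinj]
  refine finsum_congr fun y => ?_
  by_cases hy : y ∈ Set.range h
  · simp only [hy, finsum_true]
  · simp only [hy, finsum_false, hf y hy]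

variable {F : Type*} [Field F] {V : Type*} [AddCommGroup V] [Module F V]
  {M : Type*} [AddCommGroup M] [Module F M] {W : Type*} [AddCommGroup W] [Module F W]

theorem cauchyMul_delta₁ (G : ℤ → ℤ → W) (a b d : ℤ) :
    cauchyMul (delta₁ F) (fun e : ℤ × ℤ × ℤ => if e.1 = 0 then G e.2.1 e.2.2 else 0) (a, b, d) =
      deltaMul (-1 : F) G a b d := by
  rw [cauchyMul, deltaMul, finsum_eq_finsum_comp (h := fun i : ℕ => (a, -a - 1 - (i : ℤ), (i : ℤ)))]
  · refine finsum_congr fun i => ?_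
    simp only [Prod.mk_sub_mk, sub_self, if_true, delta₁, binomExp]
    rw [if_pos (by omega), Int.toNat_natCast]
    congr 2
    ring
  · intro i j hij
    simpa using hij
  · rintro ⟨x, y, z⟩ hx
    simp only [Prod.mk_sub_mk, delta₁, binomExp]
    by_cases h1 : a - x = 0
    · rw [if_neg, zero_smul]
      rintro ⟨h2, h3⟩
      refine hx ⟨z.toNat, ?_⟩
      simp only [Prod.mk.injEq]
      omega
    · rw [if_neg h1, smul_zero]

theorem cauchyMul_delta₂ (G : ℤ → ℤ → W) (a b d : ℤ) :
    cauchyMul (delta₂ F) (fun e : ℤ × ℤ × ℤ => if e.1 = 0 then G e.2.2 e.2.1 else 0) (a, b, d) =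
      (-1 : F) ^ (-a - 1) • deltaMul (-1 : F) G a d b := by
  rw [cauchyMul, deltaMul, smul_finsum,
    finsum_eq_finsum_comp (h := fun i : ℕ => (a, (i : ℤ), -a - 1 - (i : ℤ)))]
  · refine finsum_congr fun i => ?_
    simp only [Prod.mk_sub_mk, sub_self, if_true, delta₂, binomExp]
    rw [if_pos (by omega), Int.toNat_natCast, smul_smul]
    congr 2
    ring
  · intro i j hij
    simp only [Prod.mk.injEq] at hij
    omega
  · rintro ⟨x, y, z⟩ hx
    simp only [Prod.mk_sub_mk, delta₂, binomExp]
    by_cases h1 : a - x = 0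
    · rw [if_neg, mul_zero, zero_smul]
      rintro ⟨h2, h3⟩
      refine hx ⟨y.toNat, ?_⟩
      simp only [Prod.mk.injEq]
      omega
    · rw [if_neg h1, smul_zero]

/-- Here the delta function is rewritten as `x₁⁻¹ δ((x₂ + x₀) / x₁)`, so that the expansion raises
the exponent of `x₂`, the variable in which `Y_M(x₂) w` is truncated. -/
theorem cauchyMul_delta₃ (G : ℤ → ℤ → W) (a b d : ℤ) :
    cauchyMul (delta₃ F) (fun e : ℤ × ℤ × ℤ => if e.2.1 = 0 then G e.2.2 e.1 else 0) (a, b, d) =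
      deltaMul (1 : F) G b d a := by
  rw [cauchyMul, deltaMul,
    finsum_eq_finsum_comp (h := fun i : ℕ => ((i : ℤ), b, -b - (i : ℤ) - 1))]
  · refine finsum_congr fun i => ?_
    simp only [Prod.mk_sub_mk, sub_self, if_true, delta₃, binomExp]
    rw [if_pos (by omega), Int.toNat_natCast, choose_neg_sub_one b, one_pow, mul_one]
    have h1 : -(-b - (i : ℤ) - 1) - 1 = b + i := by ring
    rw [h1]
    congr 2
    ring
  · intro i j hij
    simp only [Prod.mk.injEq] at hij
    omega
  · rintro ⟨x, y, z⟩ hx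
    simp only [Prod.mk_sub_mk, delta₃, binomExp]
    by_cases h1 : b - y = 0
    · rw [if_neg, zero_smul]
      rintro ⟨h2, h3⟩
      refine hx ⟨x.toNat, ?_⟩
      simp only [Prod.mk.injEq]
      omega
    · rw [if_neg h1, smul_zero]

theorem cauchyMul_binomExp (g : ℤ × ℤ → W) (k : ℕ) (a d : ℤ) :
    cauchyMul (binomExp F 1 (k : ℤ)) g (a, d) =
      ∑ ij ∈ Finset.HasAntidiagonal.antidiagonal k, k.choose ij.1 • g (a - ij.2, d - ij.1) := by
  rw [cauchyMul, finsum_eq_finsum_comp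
    (h := fun i : ℕ => ((k : ℤ) - (i : ℤ), (i : ℤ))),
    Finset.Nat.sum_antidiagonal_eq_sum_range_succ_mk]
  · rw [finsum_eq_sum_of_support_subset (s := Finset.range (k + 1))]
    · refine Finset.sum_congr rfl fun i hi => ?_
      rw [Finset.mem_range] at hi
      simp only [binomExp]
      rw [if_pos (by omega), Int.toNat_natCast, one_pow, mul_one, Ring.choose_natCast]
      rw [Int.cast_natCast, Nat.cast_smul_eq_nsmul, Prod.mk_sub_mk, Nat.cast_sub (by omega)]
    · intro i hi
      simp only [Finset.coe_range, Set.mem_Iio]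
      by_contra h
      refine hi ?_
      simp only [binomExp, Int.toNat_natCast, Ring.choose_natCast]
      rw [Nat.choose_eq_zero_of_lt (by omega)]
      simp
  · intro i j hij
    simp only [Prod.mk.injEq] at hij
    omega
  · rintro ⟨x, y⟩ hx
    simp only [binomExp]
    rw [if_neg, zero_smul]
    rintro ⟨h2, h3⟩
    refine hx ⟨y.toNat, ?_⟩
    simp only [Prod.mk.injEq] at *
    omega

theorem substAdd_apply (f : ℤ → W) (a d : ℤ) :
    substAdd (F := F) f (a, d) =
      if 0 ≤ d then ((Ring.choose (a + d) d.toNat : ℤ) : F) • f (a + d) else 0 := by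
  rw [substAdd, finsum_eq_single _ (a + d)]
  · simp only [binomExp, and_true, one_pow, mul_one]
    split_ifs <;> simp
  · intro n hn
    rw [binomExp, if_neg (fun h => hn h.2.symm), zero_smul]

variable (YV : V →ₗ[F] (ℤ → V ⊗[F] V)) (YM : M →ₗ[F] (ℤ → V ⊗[F] M))

/-- `(Id_V ⊗ Y_M(z)) Y_M(y) w`, as a function of the exponents of `y` and `z`. -/
def rightSeries (w : M) (p q : ℤ) : V ⊗[F] (V ⊗[F] M) := iterRight YM w (p, q)

/-- `(T ⊗ Id_M) (Id_V ⊗ Y_M(z)) Y_M(y) w`, as a function of the exponents of `y` and `z`. -/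
def rightSeriesSwap (w : M) (p q : ℤ) : V ⊗[F] (V ⊗[F] M) :=
  TensorProduct.leftComm F V V M (rightSeries YM w p q)

/-- `(Y_V(z) ⊗ Id_M) Y_M(y) w`, as a function of the exponents of `y` and `z`. -/
def leftSeries (w : M) (q p : ℤ) : V ⊗[F] (V ⊗[F] M) := iterLeft YV YM w (p, q)

theorem jacobiIdentity_iff : JacobiIdentity YV YM ↔ ∀ (w : M) (a b d : ℤ),
    deltaMul (-1 : F) (rightSeries YM w) a b d -
      (-1 : F) ^ (-a - 1) • deltaMul (-1 : F) (rightSeriesSwap YM w) a d b =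
    deltaMul (1 : F) (leftSeries YV YM w) b d a := by
  refine forall_congr' fun w => ?_
  rw [funext_iff]
  simp only [Prod.forall, Pi.sub_apply]
  refine forall_congr' fun a => forall_congr' fun b => forall_congr' fun d => ?_
  rw [← cauchyMul_delta₁, ← cauchyMul_delta₂, ← cauchyMul_delta₃]
  rfl

variable {YV YM}

theorem Truncation.upperBounded_rightSeries (h : Truncation YM) (w : M) :
    UpperBounded (rightSeries YM w) := by
  obtain ⟨N, hN⟩ := h w
  exact ⟨N, fun p q hp => by simp [rightSeries, iterRight, hN p hp]⟩

theorem Truncation.upperBounded_rightSeriesSwap (h : Truncation YM) (w : M) :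
    UpperBounded (rightSeriesSwap YM w) :=
  (h.upperBounded_rightSeries w).map (TensorProduct.leftComm F V V M).toLinearMap

theorem Truncation.upperBounded_leftSeries (h : Truncation YM) (w : M) :
    UpperBounded (leftSeries YV YM w) := by
  obtain ⟨N, hN⟩ := h w
  exact ⟨N, fun p q hp => by simp [leftSeries, iterLeft, hN p hp]⟩

/-- Taking the residue in `x₁` substitutes `x₀ + x₂` for `x₁`. With `iterLeft_eq`, this makes weak
coassociativity a statement about the slice `b = -1` of the first and third terms. -/
theorem iterRightShift_eq (w : M) (a d : ℤ) :
    iterRightShift YM w (a, d) = deltaMul (-1 : F) (rightSeries YM w) a (-1) d := by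
  rw [iterRightShift, deltaMul, finsum_eq_finsum_comp (h := fun i : ℕ => (i : ℤ))]
  · refine finsum_congr fun i => ?_
    rw [substAdd_apply, if_pos (by omega), Int.toNat_natCast, choose_neg_sub_one, map_smul,
      mul_assoc, ← mul_pow]
    simp only [mul_neg, mul_one, neg_neg, one_pow, rightSeries, iterRight, neg_add_cancel_right]
  · exact Nat.cast_injective
  · intro i hi
    rw [substAdd_apply, if_neg, map_zero]
    exact fun h => hi ⟨i.toNat, by simp [h]⟩

theorem iterLeft_eq (w : M) (a d : ℤ) :
    iterLeft YV YM w (a, d) = deltaMul (1 : F) (leftSeries YV YM w) (-1) d a := by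
  rw [deltaMul_neg_one, leftSeries]

theorem rightSeries_add (w w' : M) : rightSeries YM (w + w') =
    fun p q => rightSeries YM w p q + rightSeries YM w' p q := by
  ext; simp [rightSeries, iterRight]

theorem rightSeriesSwap_add (w w' : M) : rightSeriesSwap YM (w + w') =
    fun p q => rightSeriesSwap YM w p q + rightSeriesSwap YM w' p q := by
  ext; simp [rightSeriesSwap, rightSeries_add]

theorem leftSeries_add (w w' : M) : leftSeries YV YM (w + w') =
    fun p q => leftSeries YV YM w p q + leftSeries YV YM w' p q := by
  ext; simp [leftSeries, iterLeft]

theorem rightSeries_zero : rightSeries YM 0 = fun _ _ => 0 := by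
  ext; simp [rightSeries, iterRight]

theorem rightSeriesSwap_zero : rightSeriesSwap YM 0 = fun _ _ => 0 := by
  ext; simp [rightSeriesSwap, rightSeries_zero]

theorem leftSeries_zero : leftSeries YV YM 0 = fun _ _ => 0 := by
  ext; simp [leftSeries, iterLeft]

end Coefficients

/-! ### Homogeneous functionals on graded tensor products -/

section Homogeneous

variable {F : Type*} [Field F] {V : Type*} [AddCommGroup V] [Module F V]
  {M : Type*} [AddCommGroup M] [Module F M] {ι : Type*}

/-- A functional that vanishes on all weight spaces except that of weight `s`. -/
def IsHomogeneousDual (ℳ : ι → Submodule F M) (s : ι) (φ : Module.Dual F M) : Prop :=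
  ∀ t, t ≠ s → ∀ m ∈ ℳ t, φ m = 0

theorem IsHomogeneousDual.mem_gradedDual {ℳ : ι → Submodule F M} {s : ι} {φ : Module.Dual F M}
    (h : IsHomogeneousDual ℳ s φ) : φ ∈ gradedDual ℳ := by
  refine (Set.finite_singleton s).subset ?_
  rintro k ⟨m, hm, hne⟩
  by_contra hk
  exact hne (h k hk m hm)

/-- Homogeneous functionals separate the points of a graded vector space. -/
theorem eq_zero_of_homogeneousDual [DecidableEq ι] {ℳ : ι → Submodule F M}
    (h : DirectSum.IsInternal ℳ) {m : M}
    (hm : ∀ s φ, IsHomogeneousDual ℳ s φ → φ m = 0) : m = 0 := by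
  let b := h.collectedBasis fun i => Module.Basis.ofVectorSpace F (ℳ i)
  refine b.ext_elem fun i => ?_
  rw [map_zero, Finsupp.zero_apply]
  exact hm i.1 (b.coord i) fun t ht m hmt => h.collectedBasis_repr_of_mem_ne _ ht hmt

variable [AddCommGroupWithOne ι] {𝒱 : ℤ → Submodule F V} {ℳ : ι → Submodule F M}

theorem tensorGrading_le {k : ι} {P : Submodule F (V ⊗[F] M)}
    (h : ∀ (i : ℤ) (j : ι), (i : ι) + j = k → ∀ v ∈ 𝒱 i, ∀ m ∈ ℳ j, v ⊗ₜ[F] m ∈ P) :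
    tensorGrading 𝒱 ℳ k ≤ P :=
  iSup_le fun i => iSup_le fun j => iSup_le fun hij =>
    Submodule.map₂_le.2 fun v hv m hm => h i j hij v hv m hm

theorem tmul_mem_tensorGrading {i : ℤ} {j k : ι} (hk : (i : ι) + j = k) {v : V} (hv : v ∈ 𝒱 i)
    {m : M} (hm : m ∈ ℳ j) : v ⊗ₜ[F] m ∈ tensorGrading 𝒱 ℳ k := by
  have h := Submodule.apply_mem_map₂ (TensorProduct.mk F V M) hv hm
  exact Submodule.mem_iSup_of_mem i (Submodule.mem_iSup_of_mem j (Submodule.mem_iSup_of_mem hk h))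

/-- Homogeneous functionals separate the points of `V ⊗ M` if they separate those of `M`. -/
theorem eq_zero_of_homogeneousDual_tensor (hV : DirectSum.IsInternal 𝒱)
    (hM : ∀ m : M, (∀ s φ, IsHomogeneousDual ℳ s φ → φ m = 0) → m = 0) {z : V ⊗[F] M}
    (hz : ∀ s φ, IsHomogeneousDual (tensorGrading 𝒱 ℳ) s φ → φ z = 0) : z = 0 := by
  classical
  let b := hV.collectedBasis fun i => Module.Basis.ofVectorSpace F (𝒱 i)
  -- Expanding in a homogeneous basis of `V` reduces to coordinates in `M`. Directness of the weight
  -- spaces of `M` is not needed, so the argument can be iterated with `V ⊗ M` in place of `M`.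
  refine (TensorProduct.equivFinsuppOfBasisLeft b).injective (Finsupp.ext fun i => ?_)
  rw [map_zero, Finsupp.zero_apply, TensorProduct.equivFinsuppOfBasisLeft_apply]
  refine hM _ fun s ψ hψ => ?_
  refine hz (i.1 + s) (ψ ∘ₗ (TensorProduct.lid F M).toLinearMap ∘ₗ (b.coord i).rTensor M) ?_
  intro t ht x hx
  suffices h : tensorGrading 𝒱 ℳ t ≤ LinearMap.ker
      (ψ ∘ₗ (TensorProduct.lid F M).toLinearMap ∘ₗ (b.coord i).rTensor M) from h hx
  refine tensorGrading_le fun i' j hij v hv m hm => ?_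
  simp only [LinearMap.mem_ker, LinearMap.comp_apply, LinearMap.rTensor_tmul,
    LinearEquiv.coe_coe, TensorProduct.lid_tmul, map_smul, smul_eq_mul]
  by_cases hi : i' = i.1
  · rw [hψ j (by rintro rfl; exact ht (by rw [← hij, hi])) m hm, mul_zero]
  · have h : b.coord i v = 0 := hV.collectedBasis_repr_of_mem_ne _ hi hv
    rw [h, zero_mul]

theorem leftComm_mem_tensorGrading {k : ι} {z : V ⊗[F] (V ⊗[F] M)}
    (hz : z ∈ tensorGrading 𝒱 (tensorGrading 𝒱 ℳ) k) :
    TensorProduct.leftComm F V V M z ∈ tensorGrading 𝒱 (tensorGrading 𝒱 ℳ) k := by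
  suffices h : tensorGrading 𝒱 (tensorGrading 𝒱 ℳ) k ≤
      (tensorGrading 𝒱 (tensorGrading 𝒱 ℳ) k).comap
        (TensorProduct.leftComm F V V M).toLinearMap from h hz
  refine tensorGrading_le fun i j hij v hv m hm => ?_
  suffices h : tensorGrading 𝒱 ℳ j ≤ (tensorGrading 𝒱 (tensorGrading 𝒱 ℳ) k).comap
      ((TensorProduct.leftComm F V V M).toLinearMap ∘ₗ TensorProduct.mk F V _ v) from h hm
  refine tensorGrading_le fun i' j' hij' v' hv' m' hm' => ?_
  simp only [Submodule.mem_comap, LinearMap.comp_apply, TensorProduct.mk_apply,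
    LinearEquiv.coe_coe, TensorProduct.leftComm_tmul]
  refine tmul_mem_tensorGrading (j := (i : ι) + j') ?_ hv' (tmul_mem_tensorGrading rfl hv hm')
  rw [← hij, ← hij', add_left_comm]

theorem IsHomogeneousDual.comp_leftComm {s : ι} {φ : Module.Dual F (V ⊗[F] (V ⊗[F] M))}
    (h : IsHomogeneousDual (tensorGrading 𝒱 (tensorGrading 𝒱 ℳ)) s φ) :
    IsHomogeneousDual (tensorGrading 𝒱 (tensorGrading 𝒱 ℳ)) s
      (φ ∘ₗ (TensorProduct.leftComm F V V M).toLinearMap) :=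
  fun t ht _ hm => h t ht _ (leftComm_mem_tensorGrading hm)

theorem IsGradedMap.coeff_mem {YM : M →ₗ[F] (ℤ → V ⊗[F] M)} (h : IsGradedMap 𝒱 ℳ YM) {j : ι}
    {w : M} (hw : w ∈ ℳ j) (n : ℤ) : YM w n ∈ tensorGrading 𝒱 ℳ (j - n) := by
  have h1 := h j (-n - 1) w hw
  have h2 : -(-n - 1) - 1 = n := by ring
  have h3 : j + ((-n - 1 : ℤ) : ι) + 1 = j - n := by push_cast; abel
  rwa [comult, h2, h3] at h1

theorem IsGradedMap.rightSeries_mem {YM : M →ₗ[F] (ℤ → V ⊗[F] M)} (h : IsGradedMap 𝒱 ℳ YM)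
    {j : ι} {w : M} (hw : w ∈ ℳ j) (p q : ℤ) :
    rightSeries YM w p q ∈ tensorGrading 𝒱 (tensorGrading 𝒱 ℳ) (j - p - q) := by
  suffices h' : tensorGrading 𝒱 ℳ (j - p) ≤
      (tensorGrading 𝒱 (tensorGrading 𝒱 ℳ) (j - p - q)).comap
        (LinearMap.lTensor V (coeff YM q)) from h' (h.coeff_mem hw p)
  refine tensorGrading_le fun i j' hij v hv m hm => ?_
  rw [Submodule.mem_comap, LinearMap.lTensor_tmul]
  refine tmul_mem_tensorGrading ?_ hv (h.coeff_mem hm q)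
  rw [← hij]; abel

theorem IsHomogeneousDual.comp_lTensor_counitLeft {c : V →ₗ[F] F}
    (hc : ∀ r : ℤ, r ≠ 0 → ∀ v ∈ 𝒱 r, c v = 0) {s : ι} {ψ : Module.Dual F (V ⊗[F] M)}
    (h : IsHomogeneousDual (tensorGrading 𝒱 ℳ) s ψ) :
    IsHomogeneousDual (tensorGrading 𝒱 (tensorGrading 𝒱 ℳ)) s
      (ψ ∘ₗ LinearMap.lTensor V (counitLeft M c)) := by
  intro t ht x hx
  suffices h' : tensorGrading 𝒱 (tensorGrading 𝒱 ℳ) t ≤ LinearMap.ker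
      (ψ ∘ₗ LinearMap.lTensor V (counitLeft M c)) from h' hx
  refine tensorGrading_le fun i j hij v hv m hm => ?_
  suffices h' : tensorGrading 𝒱 ℳ j ≤ LinearMap.ker
      ((ψ ∘ₗ LinearMap.lTensor V (counitLeft M c)) ∘ₗ TensorProduct.mk F V _ v) from h' hm
  refine tensorGrading_le fun i' j' hij' v' hv' m' hm' => ?_
  simp only [LinearMap.mem_ker, LinearMap.comp_apply, TensorProduct.mk_apply,
    LinearMap.lTensor_tmul, counitLeft, LinearMap.rTensor_tmul, LinearEquiv.coe_coe,
    TensorProduct.lid_tmul]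
  by_cases hi : i' = 0
  · refine h t ht _ (tmul_mem_tensorGrading (j := j') ?_ hv (Submodule.smul_mem _ _ hm'))
    rw [← hij, ← hij', hi, Int.cast_zero, zero_add]
  · rw [hc i' hi v' hv', zero_smul, TensorProduct.tmul_zero, map_zero]

end Homogeneous

/-! ### Lower bounds on exponents after pairing -/

section Rational

variable {F : Type*} [Field F] {V : Type*} [AddCommGroup V] [Module F V]
  {M : Type*} [AddCommGroup M] [Module F M] {𝒱 : ℤ → Submodule F V} {ℳ : ℚ → Submodule F M}
  {YM : M →ₗ[F] (ℤ → V ⊗[F] M)}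

theorem exists_forall_le_apply_coeff_eq_zero (hYM : IsGradedMap 𝒱 ℳ YM) {s j : ℚ}
    {ψ : Module.Dual F (V ⊗[F] M)} (hψ : IsHomogeneousDual (tensorGrading 𝒱 ℳ) s ψ) {w : M}
    (hw : w ∈ ℳ j) : ∃ K : ℤ, ∀ n : ℤ, n ≤ K → ψ (YM w n) = 0 := by
  obtain ⟨K, hK⟩ := exists_int_lt (j - s)
  refine ⟨K, fun n hn => hψ _ ?_ _ (hYM.coeff_mem hw n)⟩
  have : (n : ℚ) ≤ K := by exact_mod_cast hn
  intro h
  linarith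

/-- The coefficient has weight `j - p - q`, and truncation gives `p ≤ N`. Weight `s` therefore
forces `q ≥ j - s - N`. -/
theorem exists_forall_le_apply_rightSeries_eq_zero (hYM : IsGradedMap 𝒱 ℳ YM)
    (ht : Truncation YM) {s j : ℚ} {φ : Module.Dual F (V ⊗[F] (V ⊗[F] M))}
    (hφ : IsHomogeneousDual (tensorGrading 𝒱 (tensorGrading 𝒱 ℳ)) s φ) {w : M}
    (hw : w ∈ ℳ j) : ∃ K : ℤ, ∀ p q : ℤ, q ≤ K → φ (rightSeries YM w p q) = 0 := by
  obtain ⟨N, hN⟩ := ht.upperBounded_rightSeries w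
  obtain ⟨K, hK⟩ := exists_int_lt (j - s - N)
  refine ⟨K, fun p q hq => ?_⟩
  by_cases hp : N < p
  · rw [hN p q hp, map_zero]
  · refine hφ _ ?_ _ (hYM.rightSeries_mem hw p q)
    have h1 : (q : ℚ) ≤ K := by exact_mod_cast hq
    have h2 : (p : ℚ) ≤ N := by exact_mod_cast not_lt.1 hp
    intro h
    linarith

end Rational

/-! ### The weight of the counit -/

section Counit

variable {F : Type*} [Field F] {V : Type*} [AddCommGroup V] [Module F V]
  {𝒱 : ℤ → Submodule F V} {Y : V →ₗ[F] (ℤ → V ⊗[F] V)} {c : V →ₗ[F] F}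

/-- The projection onto a weight space. -/
theorem exists_projection (h : DirectSum.IsInternal 𝒱) (r : ℤ) : ∃ π : V →ₗ[F] V,
    (∀ v ∈ 𝒱 r, π v = v) ∧ ∀ i, i ≠ r → ∀ v ∈ 𝒱 i, π v = 0 := by
  let e := LinearEquiv.ofBijective (DirectSum.coeLinearMap 𝒱) h
  have he : ∀ i (v : 𝒱 i), e.symm v = DirectSum.lof F ℤ (fun i => 𝒱 i) i v := by
    intro i v
    rw [LinearEquiv.symm_apply_eq]
    exact (DirectSum.coeLinearMap_lof 𝒱 i v).symm
  refine ⟨(𝒱 r).subtype ∘ₗ DirectSum.component F ℤ (fun i => 𝒱 i) r ∘ₗ e.symm.toLinearMap,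
    fun v hv => ?_, fun i hi v hv => ?_⟩
  · have := he r ⟨v, hv⟩
    simp only [LinearMap.comp_apply, LinearEquiv.coe_coe]
    rw [this, DirectSum.component.lof_self]
    rfl
  · have := he i ⟨v, hv⟩
    simp only [LinearMap.comp_apply, LinearEquiv.coe_coe]
    rw [this, DirectSum.component.of, dif_neg hi, map_zero]

/-- The counit of a graded vertex coalgebra has weight `0`. -/
theorem IsGradedVertexCoalgebra.counit_eq_zero (hV : IsGradedVertexCoalgebra 𝒱 Y c) (r : ℤ)
    (hr : r ≠ 0) (v : V) (hv : v ∈ 𝒱 r) : c v = 0 := by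
  obtain ⟨π, hπ, hπ'⟩ := exists_projection hV.grading.isInternal 0
  obtain ⟨ρ, hρ, hρ'⟩ := exists_projection hV.grading.isInternal r
  have hmem : Y v 0 ∈ tensorGrading 𝒱 𝒱 r := by
    simpa using hV.graded.coeff_mem hv 0
  -- In total weight `r`, projecting the second factor to weight `r` is the same as projecting the
  -- first to weight `0`. Moving the latter projection to the other counit axiom gives `c v = c (π
  -- v) = 0`.
  have h1 : ρ (counitLeft V c (Y v 0)) = counitLeft V (c ∘ₗ π) (Y v 0) := by
    suffices h : tensorGrading 𝒱 𝒱 r ≤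
        LinearMap.ker (ρ ∘ₗ counitLeft V c - counitLeft V (c ∘ₗ π)) by
      exact sub_eq_zero.1 (h hmem)
    refine tensorGrading_le fun i j hij u hu u' hu' => ?_
    simp only [Int.cast_id] at hij
    simp only [LinearMap.mem_ker, LinearMap.sub_apply, LinearMap.comp_apply, counitLeft,
      LinearMap.rTensor_tmul, LinearEquiv.coe_coe, TensorProduct.lid_tmul, map_smul]
    by_cases hi : i = 0
    · subst hi
      rw [hπ u hu, hρ u' (by rwa [← hij, zero_add]), sub_self]
    · rw [hπ' i hi u hu, hρ' j (by omega) u' hu', map_zero, smul_zero, zero_smul, sub_zero]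
  have h2 : c (counitLeft V (c ∘ₗ π) (Y v 0)) = c (π (counitRight c (Y v 0))) := by
    suffices h : c ∘ₗ counitLeft V (c ∘ₗ π) = c ∘ₗ π ∘ₗ counitRight c from LinearMap.congr_fun h _
    ext u u'
    simp [counitLeft, counitRight, mul_comm]
  rw [hV.leftCounit v 0, if_pos rfl, hρ v hv] at h1
  rw [← h1, (hV.cocreation v).2, hπ' r hr v hv, map_zero] at h2
  exact h2

end Counit

/-! ### Counit identities and skew symmetry in the vertex coalgebra -/

section SkewSymmetry

variable {F : Type*} [Field F] {V : Type*} [AddCommGroup V] [Module F V]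
  {M : Type*} [AddCommGroup M] [Module F M]
  {YV : V →ₗ[F] (ℤ → V ⊗[F] V)} {YM : M →ₗ[F] (ℤ → V ⊗[F] M)} {c : V →ₗ[F] F}

/-- The coefficient of `x ^ n` in `(Id_V ⊗ c) Y(x)`. -/
def counitCoeff (YV : V →ₗ[F] (ℤ → V ⊗[F] V)) (c : V →ₗ[F] F) (n : ℤ) : V →ₗ[F] V :=
  counitRight c ∘ₗ coeff YV n

theorem lTensor_counitLeft_rightSeries (h : LeftCounit c YM) (w : M) (p q : ℤ) :
    LinearMap.lTensor V (counitLeft M c) (rightSeries YM w p q) =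
      if q = 0 then YM w p else 0 := by
  have h1 : counitLeft M c ∘ₗ coeff YM q = if q = 0 then LinearMap.id else 0 := by
    ext m
    have := h m q
    split_ifs with hq <;> simpa [coeff, hq] using this
  rw [rightSeries, iterRight, ← LinearMap.comp_apply, ← LinearMap.lTensor_comp, h1]
  split_ifs <;> simp

theorem counitLeft_rightSeries (h : LeftCounit c YM) (w : M) (p q : ℤ) :
    counitLeft (V ⊗[F] M) c (rightSeries YM w p q) = if p = 0 then YM w q else 0 := by
  have h1 : counitLeft (V ⊗[F] M) c ∘ₗ LinearMap.lTensor V (coeff YM q) =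
      coeff YM q ∘ₗ counitLeft M c := by
    ext v m
    simp [counitLeft]
  rw [rightSeries, iterRight]
  refine (LinearMap.congr_fun h1 (YM w p)).trans ?_
  rw [LinearMap.comp_apply, h w p]
  split_ifs <;> simp [coeff]

theorem lTensor_counitLeft_leftComm (z : V ⊗[F] (V ⊗[F] M)) :
    LinearMap.lTensor V (counitLeft M c) (TensorProduct.leftComm F V V M z) =
      counitLeft (V ⊗[F] M) c z := by
  suffices h : LinearMap.lTensor V (counitLeft M c) ∘ₗ
      (TensorProduct.leftComm F V V M).toLinearMap = counitLeft (V ⊗[F] M) c from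
    LinearMap.congr_fun h z
  ext u v m
  simp [counitLeft]

theorem lTensor_counitLeft_leftSeries (w : M) (q p : ℤ) :
    LinearMap.lTensor V (counitLeft M c) (leftSeries YV YM w q p) =
      LinearMap.rTensor M (counitCoeff YV c p) (YM w q) := by
  have h1 : LinearMap.lTensor V (counitLeft M c) ∘ₗ (TensorProduct.assoc F V V M).toLinearMap =
      LinearMap.rTensor M (counitRight c) := by
    ext u v m
    simp [counitLeft, counitRight, TensorProduct.smul_tmul]
  rw [counitCoeff, LinearMap.rTensor_comp, ← h1]
  rfl

theorem lTensor_counitRight_leftSeries (v : V) (q p : ℤ) :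
    LinearMap.lTensor V (counitRight c) (leftSeries YV YV v q p) =
      YV (counitCoeff YV c q v) p := by
  have h1 : LinearMap.lTensor V (counitRight c) ∘ₗ (TensorProduct.assoc F V V V).toLinearMap ∘ₗ
      LinearMap.rTensor V (coeff YV p) = coeff YV p ∘ₗ counitRight c := by
    have h2 : LinearMap.lTensor V (counitRight c) ∘ₗ
        (TensorProduct.assoc F V V V).toLinearMap =
          (TensorProduct.rid F (V ⊗[F] V)).toLinearMap ∘ₗ LinearMap.lTensor (V ⊗[F] V) c := by
      ext u v m
      simp [counitRight]
    rw [← LinearMap.comp_assoc, h2]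
    ext u v
    simp [counitRight]
  exact LinearMap.congr_fun h1 (YV v q)

theorem lTensor_counitRight_leftComm (z : V ⊗[F] (V ⊗[F] V)) :
    LinearMap.lTensor V (counitRight c) (TensorProduct.leftComm F V V V z) =
      TensorProduct.comm F V V (LinearMap.lTensor V (counitRight c) z) := by
  suffices h : LinearMap.lTensor V (counitRight c) ∘ₗ
      (TensorProduct.leftComm F V V V).toLinearMap =
        (TensorProduct.comm F V V).toLinearMap ∘ₗ LinearMap.lTensor V (counitRight c) from
    LinearMap.congr_fun h z
  ext u v m
  simp [counitRight]

theorem counitRight_rTensor (f : V →ₗ[F] V) (z : V ⊗[F] V) :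
    counitRight c (LinearMap.rTensor V f z) = f (counitRight c z) := by
  suffices h : counitRight c ∘ₗ LinearMap.rTensor V f = f ∘ₗ counitRight c from
    LinearMap.congr_fun h z
  ext u v
  simp [counitRight]

theorem leftComm_leftComm (z : V ⊗[F] (V ⊗[F] M)) :
    TensorProduct.leftComm F V V M (TensorProduct.leftComm F V V M z) = z := by
  suffices h : (TensorProduct.leftComm F V V M).toLinearMap ∘ₗ
      (TensorProduct.leftComm F V V M).toLinearMap = LinearMap.id from LinearMap.congr_fun h z
  ext u v m
  simp

theorem leftComm_deltaMul_rightSeriesSwap (ht : Truncation YM) (w : M) (a b d : ℤ) :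
    TensorProduct.leftComm F V V M (deltaMul (-1 : F) (rightSeriesSwap YM w) a b d) =
      deltaMul (-1 : F) (rightSeries YM w) a b d := by
  refine (map_deltaMul (TensorProduct.leftComm F V V M).toLinearMap (-1)
    (ht.upperBounded_rightSeriesSwap w) a b d).trans ?_
  simp only [LinearEquiv.coe_coe, rightSeriesSwap, leftComm_leftComm]

theorem counitCoeff_zero (h : Cocreation c YV) : counitCoeff YV c 0 = LinearMap.id :=
  LinearMap.ext fun v => (h v).2

theorem counitCoeff_of_neg (h : Cocreation c YV) {n : ℤ} (hn : n < 0) : counitCoeff YV c n = 0 :=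
  LinearMap.ext fun v => (h v).1 n hn

/-- With `E(x) = (Id ⊗ c) Y(x)`, this is `E(x₀) E(x₂) = E(x₀ + x₂)`: apply `Id ⊗ c ⊗ c` to (J) and
take the residue in `x₁`. -/
theorem IsVertexCoalgebra.counitCoeff_counitCoeff (h : IsVertexCoalgebra YV c) {a d : ℤ}
    (ha : 0 ≤ a) (hd : 0 ≤ d) (v : V) :
    counitCoeff YV c a (counitCoeff YV c d v) =
      ((Ring.choose (a + d) d.toNat : ℤ) : F) • counitCoeff YV c (a + d) v := by
  have hJ := (jacobiIdentity_iff YV YV).1 h.jacobi v a (-1) d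
  apply_fun counitRight c ∘ₗ LinearMap.lTensor V (counitLeft V c) at hJ
  rw [map_sub, map_smul, map_deltaMul _ _ (h.truncation.upperBounded_rightSeries v),
    map_deltaMul _ _ (h.truncation.upperBounded_rightSeriesSwap v), deltaMul_neg_one] at hJ
  simp only [LinearMap.comp_apply, rightSeriesSwap, lTensor_counitLeft_leftComm,
    counitLeft_rightSeries h.leftCounit, lTensor_counitLeft_rightSeries h.leftCounit,
    lTensor_counitLeft_leftSeries, counitRight_rTensor, apply_ite (counitRight c), map_zero] at hJ
  rw [deltaMul_const (fun p => counitRight c (YV v p)), if_pos hd] at hJ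
  -- In the second term the left counit keeps only exponent `0` of the outer variable, while the
  -- exponents that occur are at least `a + d + 1 > 0`.
  rw [deltaMul, finsum_congr (g := fun _ => 0), finsum_zero, smul_zero, sub_zero] at hJ
  · have e : a + -1 + d + 1 = a + d := by ring
    rw [e] at hJ
    exact hJ.symm
  · intro i
    rw [if_neg (by omega), smul_zero]

/-- `(Id_V ⊗ c) Y(x) = e ^ (x D*)`. -/
theorem IsVertexCoalgebra.counitCoeff_eq [CharZero F] (h : IsVertexCoalgebra YV c) (n : ℕ) :
    counitCoeff YV c n = ((n.factorial : F)⁻¹) • Dstar YV c ^ n := by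
  induction n with
  | zero => simp [counitCoeff_zero h.cocreation, Module.End.one_eq_id]
  | succ n ih =>
    ext v
    have h1 := h.counitCoeff_counitCoeff (a := 1) (d := n) (by omega) (by omega) v
    have h2 : (1 : ℤ) + n = ((n + 1 : ℕ) : ℤ) := by push_cast; ring
    rw [h2, Int.toNat_natCast, Ring.choose_natCast, Nat.choose_succ_self_right, ih] at h1
    have h3 : ((n + 1 : ℕ) : F) ≠ 0 := by exact_mod_cast n.succ_ne_zero
    rw [← inv_smul_eq_iff₀ (by exact_mod_cast h3)] at h1
    rw [← h1, pow_succ', LinearMap.smul_apply, LinearMap.smul_apply, map_smul, smul_smul,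
      Nat.factorial_succ]
    push_cast
    rw [mul_inv]
    rfl

/-- The left side of (J) is invariant under `T ⊗ Id` with `(x₀, x₁, x₂) ↦ (-x₀, x₂, x₁)`, since its
two terms are exchanged; hence so is the right side. -/
theorem IsVertexCoalgebra.deltaMul_leftSeries (h : IsVertexCoalgebra YV c) (v : V) (a b d : ℤ) :
    deltaMul (1 : F) (leftSeries YV YV v) b d a = (-1 : F) ^ a •
      TensorProduct.leftComm F V V V (deltaMul (1 : F) (leftSeries YV YV v) d b a) := by
  have hR := h.truncation.upperBounded_rightSeries v
  have h1 := (jacobiIdentity_iff YV YV).1 h.jacobi v a b d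
  have h2 := (jacobiIdentity_iff YV YV).1 h.jacobi v a d b
  have e1 : TensorProduct.leftComm F V V V (deltaMul (-1 : F) (rightSeries YV v) a d b) =
      deltaMul (-1 : F) (rightSeriesSwap YV v) a d b :=
    map_deltaMul (TensorProduct.leftComm F V V V).toLinearMap (-1) hR a d b
  rw [← h1, ← h2, map_sub, map_smul, e1,
    leftComm_deltaMul_rightSeriesSwap h.truncation]
  rw [neg_one_zpow_neg_sub_one, smul_sub, smul_smul, mul_neg, neg_one_zpow_mul_self]
  simp only [neg_smul, one_smul]
  abel

/-- Skew symmetry: `Y(x) = T Y(-x) e ^ (x D*)`. -/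
theorem IsVertexCoalgebra.skew_symmetry (h : IsVertexCoalgebra YV c) (v : V) (a : ℤ) :
    ∃ n₀ : ℕ, ∀ n, n₀ ≤ n → YV v a = (-1 : F) ^ a • ∑ i ∈ Finset.range n,
      (-1 : F) ^ i • TensorProduct.comm F V V (YV (counitCoeff YV c i v) (a - i)) := by
  have hL := h.truncation.upperBounded_leftSeries (YV := YV) v
  -- At `b = -1`, `d = 0`, applying `c` to the last factor leaves `Y(x) E(0) v = Y(x) v` on one side
  -- and the skew-symmetric expression on the other.
  have h1 := h.deltaMul_leftSeries v a (-1) 0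
  apply_fun LinearMap.lTensor V (counitRight c) at h1
  rw [deltaMul_neg_one, map_smul, lTensor_counitRight_leftComm, map_deltaMul _ _ hL,
    lTensor_counitRight_leftSeries, counitCoeff_zero h.cocreation, LinearMap.id_apply] at h1
  simp only [lTensor_counitRight_leftSeries] at h1
  obtain ⟨N, hN⟩ := h.truncation v
  refine ⟨(N + 1).toNat, fun n hn => ?_⟩
  rw [deltaMul_eq_sum (N := N) _ _ _ _ _ (n := n) (by omega), map_sum] at h1
  · rw [h1]
    congr 1
    refine Finset.sum_congr rfl fun i _ => ?_
    rw [choose_neg_sub_one, map_smul]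
    simp [Ring.choose_natCast]
  · intro p q hp
    simp [counitCoeff, coeff, hN p hp]

theorem IsVertexCoalgebra.skew_symmetry_rTensor (h : IsVertexCoalgebra YV c) (z : V ⊗[F] M)
    -- The truncation point depends on the vector. Allowing every `n ≥ n₀` gives the summands of a
    -- tensor a common bound.
    (a : ℤ) : ∃ n₀ : ℕ, ∀ n, n₀ ≤ n →
      TensorProduct.assoc F V V M (LinearMap.rTensor M (coeff YV a) z) =
        (-1 : F) ^ a • ∑ i ∈ Finset.range n, (-1 : F) ^ i • TensorProduct.leftComm F V V M
          (TensorProduct.assoc F V V M (LinearMap.rTensor M (coeff YV (a - i))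
            (LinearMap.rTensor M (counitCoeff YV c i) z))) := by
  induction z with
  | zero => exact ⟨0, fun n _ => by simp⟩
  | add z z' hz hz' =>
    obtain ⟨n₀, h₀⟩ := hz
    obtain ⟨n₁, h₁⟩ := hz'
    refine ⟨max n₀ n₁, fun n hn => ?_⟩
    simp only [map_add, smul_add, Finset.sum_add_distrib]
    rw [h₀ n (by omega), h₁ n (by omega)]
  | tmul v m =>
    obtain ⟨n₀, h₀⟩ := h.skew_symmetry v a
    refine ⟨n₀, fun n hn => ?_⟩
    have h1 : ∀ z : V ⊗[F] V, TensorProduct.leftComm F V V M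
        (TensorProduct.assoc F V V M (z ⊗ₜ m)) =
          TensorProduct.assoc F V V M (TensorProduct.comm F V V z ⊗ₜ m) := by
      intro z
      induction z with
      | zero => simp
      | add z z' hz hz' => simp only [TensorProduct.add_tmul, map_add, hz, hz']
      | tmul u u' => simp
    simp only [LinearMap.rTensor_tmul, h1]
    have h2 : coeff YV a v = YV v a := rfl
    rw [h2, h₀ n hn, ← TensorProduct.smul_tmul', map_smul, TensorProduct.sum_tmul, map_sum]
    simp only [← TensorProduct.smul_tmul', map_smul]
    rfl

end SkewSymmetry

/-! ### From weak coassociativity to the Jacobi identity -/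

section Comodule

variable {F : Type*} [Field F] {V : Type*} [AddCommGroup V] [Module F V]
  {M : Type*} [AddCommGroup M] [Module F M]
  {𝒱 : ℤ → Submodule F V} {YV : V →ₗ[F] (ℤ → V ⊗[F] V)} {c : V →ₗ[F] F}
  {ℳ : ℚ → Submodule F M} {YM : M →ₗ[F] (ℤ → V ⊗[F] M)}

/-- Weak coassociativity, as an equality of coefficients of the two delta function terms. -/
theorem WeakCoassociativity.exists_deltaMul_eq (hWC : WeakCoassociativity 𝒱 YV ℳ YM)
    (ht : Truncation YM) {φ : Module.Dual F (V ⊗[F] (V ⊗[F] M))}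
    (hφ : φ ∈ gradedDual (tensorGrading 𝒱 (tensorGrading 𝒱 ℳ))) (w : M) :
    ∃ K : ℤ, ∀ a b d : ℤ, b ≤ K →
      deltaMul (-1 : F) (fun p q => φ (rightSeries YM w p q)) a b d =
        deltaMul (1 : F) (fun p q => φ (leftSeries YV YM w p q)) b d a := by
  obtain ⟨k, hk⟩ := hWC φ hφ
  have hR := ht.upperBounded_rightSeries w
  have hL := ht.upperBounded_leftSeries (YV := YV) w
  have hX := (deltaRec_deltaMul_rotate (F := F) (hL.map φ)).sub
    (deltaRec_deltaMul (F := F) (hR.map φ))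
  -- Multiplying the slice `-1` by `(x₀ + x₂)ᵏ` yields the slice `-1 - k` of the difference, which
  -- therefore vanishes, as do all lower slices.
  refine ⟨-1 - k, fun a b d hb => (sub_eq_zero.1 (hX.eq_zero_of_le (fun a d => ?_) a b d hb)).symm⟩
  rw [hX.eq_sum k a (-1) d]
  have h := congrFun (hk w) (a, d)
  rw [cauchyMul_binomExp] at h
  simp only [map_sub, iterRightShift_eq, iterLeft_eq, map_deltaMul _ _ hR, map_deltaMul _ _ hL]
    at h
  exact h

/-- A nonnegative power of `y + z` has the same expansion in either direction. -/
theorem choose_toNat_symm {a d : ℤ} (h : 0 ≤ a + d) :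
    (if 0 ≤ d then Ring.choose (a + d) d.toNat else 0) =
      if 0 ≤ a then Ring.choose (d + a) a.toNat else 0 := by
  have hn : a + d = ((a + d).toNat : ℤ) := by omega
  rw [add_comm d a, hn, Ring.choose_natCast, Ring.choose_natCast]
  split_ifs with h1 h2 h2
  · rw [Nat.choose_symm_of_eq_add (b := a.toNat) (by omega)]
  · rw [Nat.choose_eq_zero_of_lt (by omega), Nat.cast_zero]
  · rw [Nat.choose_eq_zero_of_lt (by omega), Nat.cast_zero]
  · rfl

theorem IsLowerBoundedGrading.induction {ℳ : ℚ → Submodule F M} (h : IsLowerBoundedGrading ℳ)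
    {P : M → Prop} (zero : P 0) (add : ∀ x y, P x → P y → P (x + y))
    (mem : ∀ j, ∀ w ∈ ℳ j, P w) (w : M) : P w :=
  Submodule.iSup_induction ℳ (motive := P)
    (h.isInternal.submodule_iSup_eq_top.symm ▸ Submodule.mem_top : w ∈ ⨆ j, ℳ j) mem zero add

/-- `((Id_V ⊗ c) Y_V(z) ⊗ Id_M) Y_M(y) = Y_M(y + z)`. -/
theorem rTensor_counitCoeff (hV : IsGradedVertexCoalgebra 𝒱 YV c)
    (hM : IsGradedPrecomodule 𝒱 c ℳ YM) (hWC : WeakCoassociativity 𝒱 YV ℳ YM) (w : M) (d : ℤ)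
    (n : ℕ) : LinearMap.rTensor M (counitCoeff YV c n) (YM w d) =
      ((Ring.choose (d + n) n : ℤ) : F) • YM w (d + n) := by
  induction w using hM.grading.induction with
  | zero => simp
  | add x y hx hy => simp [hx, hy]
  | mem j w hw =>
  rw [← sub_eq_zero]
  refine eq_zero_of_homogeneousDual_tensor hV.grading.isInternal
    (fun m => eq_zero_of_homogeneousDual hM.grading.isInternal) fun s ψ hψ => ?_
  have hφ := hψ.comp_lTensor_counitLeft hV.counit_eq_zero
  obtain ⟨K, hK⟩ := hWC.exists_deltaMul_eq hM.truncation hφ.mem_gradedDual w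
  obtain ⟨K', hK'⟩ := exists_forall_le_apply_coeff_eq_zero hM.graded hψ hw
  have hL := (hM.truncation.upperBounded_leftSeries (YV := YV) w).map
    (ψ ∘ₗ LinearMap.lTensor V (counitLeft M c))
  have hR := (hM.truncation.upperBounded_rightSeries w).map
    (ψ ∘ₗ LinearMap.lTensor V (counitLeft M c))
  -- Exchanging the exponents of `x₀` and `x₂` in the third term only makes the comparison one with
  -- `Y_M(x₂ + x₀)`.
  have hX := (deltaRec_deltaMul (F := F) hR).sub (deltaRec_deltaMul_rotate (F := F) hL).reverse
  simp only [LinearMap.comp_apply, lTensor_counitLeft_rightSeries hM.leftCounit,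
    lTensor_counitLeft_leftSeries, apply_ite ψ, map_zero] at hK hX
  simp only [deltaMul_const (fun p => ψ (YM w p))] at hK hX
  have h0 := hX.eq_zero (K := min (min K K') (-1)) ?_ ?_ d (-1) n
  · rw [deltaMul_neg_one, if_pos (by omega), Int.toNat_natCast] at h0
    have e : d + -1 + n + 1 = d + (n : ℤ) := by ring
    rw [e] at h0
    rw [map_sub, map_smul, ← neg_sub, h0, neg_zero]
  · intro d b a hb
    rw [← hK a b d (by omega), sub_eq_zero]
    have e : a + b + d + 1 = d + b + a + 1 := by ring
    rw [e]
    -- Either the coefficient of `Y_M` pairs to zero, or `b ≤ K'` forces `0 ≤ a + d`, where both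
    -- expansions agree.
    by_cases h : d + b + a + 1 ≤ K'
    · simp [hK' _ h]
    · have h2 := choose_toNat_symm (a := a) (d := d) (by omega)
      have h3 := congrArg (fun x : ℤ => (x : F) • ψ (YM w (d + b + a + 1))) h2
      simpa only [apply_ite (Int.cast (R := F)), ite_smul, Int.cast_zero, zero_smul] using h3.symm
  -- For negative powers of `x₀` one side vanishes by its direction of expansion, the other by
  -- cocreation.
  · intro d b a ha
    rw [if_neg (by omega), zero_sub, neg_eq_zero]
    refine deltaMul_eq_zero_of_le (K := -1) _ (fun p q hq => ?_) _ _ _ (by omega)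
    rw [counitCoeff_of_neg hV.cocreation (by omega)]
    simp

/-- The consequence of skew symmetry for the right-hand side of the Jacobi identity. -/
theorem deltaMul_leftSeries_swap (hV : IsVertexCoalgebra YV c) (ht : Truncation YM)
    (hE : ∀ (w : M) (d : ℤ) (n : ℕ), LinearMap.rTensor M (counitCoeff YV c n) (YM w d) =
      ((Ring.choose (d + n) n : ℤ) : F) • YM w (d + n)) (w : M) (a b d : ℤ) :
    deltaMul (1 : F) (leftSeries YV YM w) b d a = (-1 : F) ^ a •
      deltaMul (1 : F) (fun p q => TensorProduct.leftComm F V V M (leftSeries YV YM w p q))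
        d b a := by
  have hL := ht.upperBounded_leftSeries (YV := YV) w
  have hL' : UpperBounded fun p q => TensorProduct.leftComm F V V M (leftSeries YV YM w p q) :=
    hL.map (TensorProduct.leftComm F V V M).toLinearMap
  -- The slice `b = -1`: skew symmetry of `V`, with `e ^ (x₀ D*)` absorbed into `Y_M(x₂ + x₀)` by
  -- `hE`.
  have hinit : ∀ a d : ℤ, leftSeries YV YM w d a = (-1 : F) ^ a •
      deltaMul (1 : F) (fun p q => TensorProduct.leftComm F V V M (leftSeries YV YM w p q))
        d (-1) a := by
    intro a d
    obtain ⟨N, hN⟩ := hL'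
    obtain ⟨n₀, h₀⟩ := hV.skew_symmetry_rTensor (YM w d) a
    rw [deltaMul_eq_sum (n := max n₀ (N + 1 - d).toNat) _ hN _ _ _ (by omega)]
    refine (h₀ (max n₀ (N + 1 - d).toNat) (le_max_left _ _)).trans ?_
    congr 1
    refine Finset.sum_congr rfl fun i _ => ?_
    rw [hE, choose_neg_sub_one]
    simp only [map_smul, smul_smul, one_pow, mul_one, neg_add_cancel_right]
    rw [mul_comm]
    rfl
  have hX := (deltaRec_deltaMul_rotate (F := F) hL).sub
    ((deltaRec_deltaMul_rotate (F := F) hL').swap (F := F))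
  refine sub_eq_zero.1 (hX.eq_zero (K := -1) ?_ ?_ a b d)
  · refine hX.eq_zero_of_le fun a d => ?_
    rw [deltaMul_neg_one, ← hinit, sub_self]
  -- Applying `T ⊗ Id` to `hinit` gives the slice `d = -1`, after exchanging the roles of `b` and
  -- `d`.
  · have h := hX.swap (F := F)
    intro a b d hd
    have h0 := h.eq_zero_of_le (K := -1) (fun a b => ?_) a d b hd
    · rwa [smul_eq_zero_iff_right (zpow_ne_zero _ (by simp))] at h0
    · have h1 := congrArg (TensorProduct.leftComm F V V M) (hinit a b)
      have h2 := map_deltaMul (TensorProduct.leftComm F V V M).toLinearMap (1 : F) hL' b (-1) a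
      simp only [LinearEquiv.coe_coe, leftComm_leftComm] at h2
      rw [map_smul, h2] at h1
      rw [deltaMul_neg_one, h1, smul_smul, neg_one_zpow_mul_self, one_smul]
      exact (congrArg _ (sub_self _)).trans (smul_zero _)

variable (YV YM) in
/-- The difference of the two sides of the Jacobi identity. -/
noncomputable def jacobiDefect (w : M) (a b d : ℤ) : V ⊗[F] (V ⊗[F] M) :=
  deltaMul (-1 : F) (rightSeries YM w) a b d -
      deltaMul (1 : F) (leftSeries YV YM w) b d a +
    (-1 : F) ^ a • deltaMul (-1 : F) (rightSeriesSwap YM w) a d b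

theorem jacobiIdentity_iff_jacobiDefect :
    JacobiIdentity YV YM ↔ ∀ (w : M) (a b d : ℤ), jacobiDefect YV YM w a b d = 0 := by
  rw [jacobiIdentity_iff]
  refine forall_congr' fun w => forall_congr' fun a => forall_congr' fun b =>
    forall_congr' fun d => ?_
  rw [← sub_eq_zero, neg_one_zpow_neg_sub_one, neg_smul, sub_neg_eq_add, add_sub_right_comm]
  rfl

theorem jacobiDefect_zero (a b d : ℤ) : jacobiDefect YV YM 0 a b d = 0 := by
  simp [jacobiDefect, rightSeries_zero, rightSeriesSwap_zero, leftSeries_zero, deltaMul_zero]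

theorem jacobiDefect_add (ht : Truncation YM) (w w' : M) (a b d : ℤ) :
    jacobiDefect YV YM (w + w') a b d =
      jacobiDefect YV YM w a b d + jacobiDefect YV YM w' a b d := by
  rw [jacobiDefect, rightSeries_add, rightSeriesSwap_add, leftSeries_add,
    deltaMul_add _ (ht.upperBounded_rightSeries w) (ht.upperBounded_rightSeries w'),
    deltaMul_add _ (ht.upperBounded_rightSeriesSwap w) (ht.upperBounded_rightSeriesSwap w'),
    deltaMul_add _ (ht.upperBounded_leftSeries w) (ht.upperBounded_leftSeries w'), smul_add,
    jacobiDefect, jacobiDefect]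
  abel

theorem deltaRec_jacobiDefect (ht : Truncation YM) (w : M) :
    DeltaRec (jacobiDefect YV YM w) :=
  ((deltaRec_deltaMul (ht.upperBounded_rightSeries w)).sub
    (deltaRec_deltaMul_rotate (ht.upperBounded_leftSeries w))).add
      (deltaRec_deltaMul (ht.upperBounded_rightSeriesSwap w)).swap

/-- The two products `(Id ⊗ Y_M) Y_M` are exchanged, and the iterate is preserved by
`deltaMul_leftSeries_swap`. -/
theorem jacobiDefect_swap (hV : IsVertexCoalgebra YV c) (ht : Truncation YM)
    (hE : ∀ (w : M) (d : ℤ) (n : ℕ), LinearMap.rTensor M (counitCoeff YV c n) (YM w d) =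
      ((Ring.choose (d + n) n : ℤ) : F) • YM w (d + n)) (w : M) (a b d : ℤ) :
    jacobiDefect YV YM w a b d =
      (-1 : F) ^ a • TensorProduct.leftComm F V V M (jacobiDefect YV YM w a d b) := by
  have h1 : TensorProduct.leftComm F V V M (deltaMul (-1 : F) (rightSeries YM w) a d b) =
      deltaMul (-1 : F) (rightSeriesSwap YM w) a d b :=
    map_deltaMul (TensorProduct.leftComm F V V M).toLinearMap (-1)
      (ht.upperBounded_rightSeries w) a d b
  have h2 := map_deltaMul (TensorProduct.leftComm F V V M).toLinearMap (1 : F)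
    (ht.upperBounded_leftSeries (YV := YV) w) d b a
  simp only [LinearEquiv.coe_coe] at h2
  rw [jacobiDefect, jacobiDefect, map_add, map_sub, map_smul,
    leftComm_deltaMul_rightSeriesSwap ht, h1, h2, deltaMul_leftSeries_swap hV ht hE w a b d,
    smul_add, smul_smul, neg_one_zpow_mul_self, one_smul, smul_sub]
  abel

/-- For low powers of `x₁` weak coassociativity cancels the first term against the third. In the
second, `x₁` is the inner variable, so weights bound its exponents below. -/
theorem exists_apply_jacobiDefect_eq_zero (hM : IsGradedPrecomodule 𝒱 c ℳ YM)
    (hWC : WeakCoassociativity 𝒱 YV ℳ YM) {s j : ℚ} {φ : Module.Dual F (V ⊗[F] (V ⊗[F] M))}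
    (hφ : IsHomogeneousDual (tensorGrading 𝒱 (tensorGrading 𝒱 ℳ)) s φ) {w : M}
    (hw : w ∈ ℳ j) :
    ∃ K : ℤ, ∀ a b d : ℤ, b ≤ K → φ (jacobiDefect YV YM w a b d) = 0 := by
  obtain ⟨K, hK⟩ := hWC.exists_deltaMul_eq hM.truncation hφ.mem_gradedDual w
  obtain ⟨K', hK'⟩ := exists_forall_le_apply_rightSeries_eq_zero hM.graded hM.truncation
    hφ.comp_leftComm hw
  refine ⟨min K K', fun a b d hb => ?_⟩
  rw [jacobiDefect, map_add, map_sub, map_smul,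
    map_deltaMul _ _ (hM.truncation.upperBounded_rightSeries w),
    map_deltaMul _ _ (hM.truncation.upperBounded_rightSeriesSwap w),
    map_deltaMul _ _ (hM.truncation.upperBounded_leftSeries w), hK a b d (by omega), sub_self,
    deltaMul_eq_zero_of_le (G := fun p q => φ (rightSeriesSwap YM w p q)) _ hK' _ _ _ (by omega),
    smul_zero, add_zero]

theorem jacobiIdentity_of_weakCoassociativity (hV : IsGradedVertexCoalgebra 𝒱 YV c)
    (hM : IsGradedPrecomodule 𝒱 c ℳ YM) (hWC : WeakCoassociativity 𝒱 YV ℳ YM) :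
    JacobiIdentity YV YM := by
  rw [jacobiIdentity_iff_jacobiDefect]
  intro w
  induction w using hM.grading.induction with
  | zero => exact jacobiDefect_zero
  | add x y hx hy =>
    intro a b d
    rw [jacobiDefect_add hM.truncation, hx, hy, add_zero]
  | mem j w hw =>
  intro a b d
  refine eq_zero_of_homogeneousDual_tensor hV.grading.isInternal
    (fun m => eq_zero_of_homogeneousDual_tensor hV.grading.isInternal
      fun m => eq_zero_of_homogeneousDual hM.grading.isInternal) fun s φ hφ => ?_
  obtain ⟨K, hK⟩ := exists_apply_jacobiDefect_eq_zero hM hWC hφ hw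
  -- `jacobiDefect_swap` turns low powers of `x₂` under `φ` into low powers of `x₁` under `φ`
  -- composed with `T ⊗ Id`.
  obtain ⟨K', hK'⟩ := exists_apply_jacobiDefect_eq_zero hM hWC hφ.comp_leftComm hw
  refine ((deltaRec_jacobiDefect hM.truncation w).map φ).eq_zero (K := min K K')
    (fun a b d hb => hK a b d (by omega)) (fun a b d hd => ?_) a b d
  rw [jacobiDefect_swap hV.toIsVertexCoalgebra hM.truncation (rTensor_counitCoeff hV hM hWC),
    map_smul]
  exact (congrArg _ (hK' a d b (by omega))).trans (smul_zero _)

theorem expTensor_Dstar_eq_substAdd [CharZero F] (hV : IsGradedVertexCoalgebra 𝒱 YV c)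
    (hM : IsGradedPrecomodule 𝒱 c ℳ YM) (hWC : WeakCoassociativity 𝒱 YV ℳ YM) (w : M) :
    expTensor (Dstar YV c) YM w = substAdd (F := F) (YM w) := by
  ext ⟨a, d⟩
  rw [substAdd_apply, expTensor]
  split_ifs with h
  · obtain ⟨n, rfl⟩ := Int.eq_ofNat_of_zero_le h
    rw [Int.toNat_natCast, ← rTensor_counitCoeff hV hM hWC, hV.counitCoeff_eq,
      LinearMap.rTensor_smul, LinearMap.smul_apply]
  · rfl

end Comodule

end VertexCoalgebra

theorem propositionP {F : Type*} [Field F] [CharZero F]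
    {V : Type*} [AddCommGroup V] [Module F V] {M : Type*} [AddCommGroup M] [Module F M]
    (𝒱 : ℤ → Submodule F V) (YV : V →ₗ[F] (ℤ → V ⊗[F] V)) (c : V →ₗ[F] F)
    (hV : VertexCoalgebra.IsGradedVertexCoalgebra 𝒱 YV c)
    (ℳ : ℚ → Submodule F M) (YM : M →ₗ[F] (ℤ → V ⊗[F] M))
    (hM : VertexCoalgebra.IsGradedPrecomodule 𝒱 c ℳ YM)
    (hWC : VertexCoalgebra.WeakCoassociativity 𝒱 YV ℳ YM) :
    VertexCoalgebra.JacobiIdentity YV YM ∧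
      ∀ w : M, VertexCoalgebra.expTensor (VertexCoalgebra.Dstar YV c) YM w =
        VertexCoalgebra.substAdd (F := F) (YM w) :=
  ⟨VertexCoalgebra.jacobiIdentity_of_weakCoassociativity hV hM hWC,
    VertexCoalgebra.expTensor_Dstar_eq_substAdd hV hM hWC⟩
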